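/- Let $\Sigma$ denote a finite alphabet. For $x,y\in\Sigma^*$ write $x<_p y$ if $y=xz$ for some nonempty word $z$, and for an $\omega$-word $w\in\Sigma^\omega$ write $x<_p w$ if $x$ is a finite prefix of $w$. An $\omega$-word $w$ is a \emph{limit} of a language $L\subseteq\Sigma^*$ if $L$ is infinite and for each $w_0<_p w$ there is a word $x\in L$ with $w_0<_p x$. (1) There is an algorithm that, given a context-free grammar $G$ over any finite alphabet $\Sigma$ and words $u,v\in\Sigma^*$ with $v$ nonempty, decides whether the regular $\omega$-word $w=uv^\omega$ is a limit of the context-free language $L(G)$. (The letters and nonterminals are numbered injectively by natural numbers, $G$ is given by its start symbol and its finite list of productions, and one algorithm works for all alphabets and all such numberings.) (2) Let $v\in\Sigma^*$ be nonempty and let $f:\Sigma^*\to a^*$ be the map with $f(vy)=a\cdot f(y)$ for all $y\in\Sigma^*$ and $f(x)=\varepsilon$ if $v$ is not a prefix of $x$. Then $f$ is a generalized sequential mapping, i.e. it is computed by a finite-state machine that reads its input letter by letter and outputs a finite word at each step. Moreover, for every language $L\subseteq\Sigma^*$ and every $u\in\Sigma^*$, the word $uv^\omega$ is a limit of $L$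 if and only if $f(u^{-1}L)$ is infinite, where $u^{-1}L=\{y\in\Sigma^*: uy\in L\}$. -/

import Mathlib

/-- The strict prefix order on finite words: `x` is a prefix of `y` and `y` is longer. -/
def StrictPrefix {σ : Type*} (x y : List σ) : Prop :=
  ∃ z : List σ, z ≠ [] ∧ y = x ++ z

/-- The finite word `x` is a prefix of the `ω`-word `w`. -/
def OmegaPrefix {σ : Type*} (x : List σ) (w : Stream' σ) : Prop :=
  ∃ w' : Stream' σ, w = x ++ₛ w'

/-- The `ω`-word `w` is a limit of the language `L`: `L` is infinite, and every finite prefix of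
`w` is a strict prefix of some word of `L`. -/
def IsLimitOf {σ : Type*} (w : Stream' σ) (L : Language σ) : Prop :=
  Set.Infinite {x : List σ | x ∈ L} ∧
    ∀ w₀ : List σ, OmegaPrefix w₀ w → ∃ x ∈ L, StrictPrefix w₀ x

/-- The regular `ω`-word `u v v v …`, for a nonempty word `v`. -/
def regularWord {σ : Type*} (u v : List σ) (hv : v ≠ []) : Stream' σ :=
  u ++ₛ Stream'.cycle v hv

/-- Finite descriptions of context-free grammars, as inputs of algorithms: the start symbol and the
list of productions `(A, α)`. Both kinds of symbols are numbered by natural numbers; in a sentential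
form `Sum.inl i` is the terminal numbered `i` and `Sum.inr j` is the nonterminal numbered `j`. -/
abbrev GrammarCode : Type := ℕ × List (ℕ × List (ℕ ⊕ ℕ))

/-- The code of a grammar symbol under the numberings `e` of terminals and `f` of nonterminals. -/
def encodeSymbol {σ N : Type*} (e : σ → ℕ) (f : N → ℕ) : Symbol σ N → ℕ ⊕ ℕ
  | Symbol.terminal a => Sum.inl (e a)
  | Symbol.nonterminal A => Sum.inr (f A)

/-- `c` describes the context-free grammar `G` under the numberings `e` of its terminals and `f` of
its nonterminals: it names the start symbol, and lists exactly the productions of `G`, in any order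
and possibly with repetitions. -/
structure GrammarCode.Describes {σ : Type*} (c : GrammarCode) (G : ContextFreeGrammar σ)
    (e : σ → ℕ) (f : G.NT → ℕ) : Prop where
  terminal_injective : Function.Injective e
  nonterminal_injective : Function.Injective f
  initial_eq : c.1 = f G.initial
  mem_rules_iff : ∀ p : ℕ × List (ℕ ⊕ ℕ),
    p ∈ c.2 ↔ ∃ r ∈ G.rules, p = (f r.input, r.output.map (encodeSymbol e f))

/-- Every context-free grammar with finitely many symbols has a description. -/
theorem GrammarCode.exists_describes {σ : Type*} [Finite σ] (G : ContextFreeGrammar σ)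
    [Finite G.NT] : ∃ (c : GrammarCode) (e : σ → ℕ) (f : G.NT → ℕ), c.Describes G e f := by
  obtain ⟨e, he⟩ := exists_injective_nat σ
  obtain ⟨f, hf⟩ := exists_injective_nat G.NT
  refine ⟨(f G.initial, G.rules.toList.map fun r =>
    (f r.input, r.output.map (encodeSymbol e f))), e, f, he, hf, rfl, fun p => ?_⟩
  simp [eq_comm]

/-- A (deterministic) generalized sequential machine with input alphabet `σ`, output alphabet `τ`
and state set `Q`: in each step it reads one letter and emits a finite word. -/
structure GenSeqMachine (σ τ Q : Type*) where
  start : Q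
  step : Q → σ → Q
  out : Q → σ → List τ

/-- The word emitted on an input word, starting in a given state. -/
def GenSeqMachine.evalFrom {σ τ Q : Type*} (M : GenSeqMachine σ τ Q) : Q → List σ → List τ
  | _, [] => []
  | q, a :: x => M.out q a ++ M.evalFrom (M.step q a) x

/-- A generalized sequential mapping: a map on words that is computed by a generalized sequential
machine with finitely many states. -/
def IsGenSeqMapping {σ τ : Type*} (f : List σ → List τ) : Prop :=
  ∃ (Q : Type) (_ : Finite Q) (M : GenSeqMachine σ τ Q), ∀ x, f x = M.evalFrom M.start x

/-! ### Limits of languages along regular words -/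

/-! The prefixes `u v^n` are cofinal among the prefixes of `u v^ω`, so the limit property says that
every `u v^n` is a prefix of a word of `L`; infinitude of `L` is then automatic
(`isLimitOf_regularWord_iff`). For (2), a word over a one-letter alphabet is its length, and the
length of `f y` is the number of leading copies of `v` in `y`.

For (1), it suffices to test one exponent, `pumpBound`. The suffixes of `u v^ω` form a finite
automaton, and the length of the longest common prefix with `u v^ω` is the weight of a run of it. If
that weight is large, some path of the derivation tree repeats a triple (nonterminal, state before,
state after) with positive weight between the two occurrences, and pumping there makes the weight
unbounded (`Yields.unboundedRuns`, `forall_exists_wordPow_prefix`).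

Whether some derivable word has a given prefix `z` is decidable by Post's theorem: a derivation
certifies a positive answer (`yields_iff_exists_foldl`), and a finite set of triples closed under
scanning certifies a negative one (`Refutes.not_yields`, `exists_refutes`). -/

/-- The `n`-th power of a word. -/
def wordPow {σ : Type*} (v : List σ) (n : ℕ) : List σ := (List.replicate n v).flatten

theorem wordPow_succ {σ : Type*} (v : List σ) (n : ℕ) :
    wordPow v (n + 1) = v ++ wordPow v n := by
  simp [wordPow, List.replicate_succ]

theorem length_wordPow {σ : Type*} (v : List σ) (n : ℕ) :
    (wordPow v n).length = n * v.length := by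
  simp [wordPow]

theorem le_length_wordPow {σ : Type*} {v : List σ} (hv : v ≠ []) (n : ℕ) :
    n ≤ (wordPow v n).length := by
  rw [length_wordPow]
  exact Nat.le_mul_of_pos_right n (List.length_pos_iff.mpr hv)

theorem map_wordPow {σ τ : Type*} (e : σ → τ) (v : List σ) (n : ℕ) :
    (wordPow v n).map e = wordPow (v.map e) n := by
  simp [wordPow]

theorem cycle_eq_wordPow_append {σ : Type*} {v : List σ} (hv : v ≠ []) (n : ℕ) :
    Stream'.cycle v hv = wordPow v n ++ₛ Stream'.cycle v hv := by
  induction n with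
  | zero => simp [wordPow]
  | succ n ih => rw [wordPow_succ, Stream'.append_append_stream, ← ih, ← Stream'.cycle_eq]

theorem regularWord_eq_append {σ : Type*} (u : List σ) {v : List σ} (hv : v ≠ []) (n : ℕ) :
    regularWord u v hv = (u ++ wordPow v n) ++ₛ Stream'.cycle v hv := by
  rw [Stream'.append_append_stream, ← cycle_eq_wordPow_append]
  rfl

theorem take_length_append_stream {σ : Type*} (x : List σ) (s : Stream' σ) :
    (x ++ₛ s).take x.length = x := by
  rw [Stream'.take_append_of_le_length (h := le_rfl), List.take_length]

theorem OmegaPrefix.isPrefix {σ : Type*} {x z : List σ} {s : Stream' σ}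
    (h : OmegaPrefix x (z ++ₛ s)) (hl : x.length ≤ z.length) : x <+: z := by
  obtain ⟨t, ht⟩ := h
  have h1 := take_length_append_stream x t
  rw [← ht, Stream'.take_append_of_le_length (h := hl)] at h1
  exact h1 ▸ List.take_prefix _ _

theorem isLimitOf_regularWord_iff {σ : Type*} (u : List σ) {v : List σ} (hv : v ≠ [])
    (L : Language σ) :
    IsLimitOf (regularWord u v hv) L ↔ ∀ n, ∃ x ∈ L, u ++ wordPow v n <+: x := by
  constructor
  · rintro ⟨-, h⟩ n
    obtain ⟨x, hx, z, -, rfl⟩ := h (u ++ wordPow v n) ⟨_, regularWord_eq_append u hv n⟩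
    exact ⟨_, hx, List.prefix_append _ _⟩
  · intro h
    have key : ∀ w₀ : List σ, OmegaPrefix w₀ (regularWord u v hv) →
        ∃ x ∈ L, StrictPrefix w₀ x := by
      intro w₀ hw
      -- The exponent exceeds the length of `w₀`, so `x` is strictly longer than `w₀`.
      obtain ⟨x, hx, hp⟩ := h (w₀.length + 1)
      have hl := le_length_wordPow hv (w₀.length + 1)
      have hp' : w₀ <+: u ++ wordPow v (w₀.length + 1) :=
        OmegaPrefix.isPrefix (regularWord_eq_append u hv _ ▸ hw)
          (by rw [List.length_append]; omega)
      obtain ⟨z, rfl⟩ := hp'.trans hp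
      refine ⟨_, hx, z, ?_, rfl⟩
      rintro rfl
      have := hp.length_le
      simp only [List.length_append, List.append_nil] at this
      omega
    refine ⟨?_, key⟩
    refine Set.Infinite.of_image List.length (Set.infinite_of_forall_exists_gt fun n => ?_)
    obtain ⟨x, hx, hp⟩ := h (n + 1)
    refine ⟨x.length, ⟨x, hx, rfl⟩, ?_⟩
    have := hp.length_le
    have := le_length_wordPow hv (n + 1)
    simp only [List.length_append] at *
    omega

/-! ### Counting the leading copies of a word by a sequential machine -/

/-- The machine that emits one letter for each leading copy of `v` in its input. The state `i` says
that `i` letters of the current copy have been read; `v.length` is a sink. -/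
def countMachine {σ : Type*} [DecidableEq σ] (v : List σ) :
    GenSeqMachine σ Unit (Fin (v.length + 1)) where
  start := 0
  step i a :=
    if h : v[i.1]? = some a then
      if i.1 + 1 = v.length then 0
      else ⟨i.1 + 1, Nat.succ_lt_succ (List.getElem?_eq_some_iff.mp h).1⟩
    else Fin.last _
  out i a := if v[i.1]? = some a ∧ i.1 + 1 = v.length then [()] else []

theorem countMachine_evalFrom_last {σ : Type*} [DecidableEq σ] (v x : List σ) :
    (countMachine v).evalFrom (Fin.last _) x = [] := by
  induction x with
  | nil => rfl
  | cons a x ih =>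
    have h : v[(Fin.last v.length).1]? ≠ some a := by simp
    simp only [GenSeqMachine.evalFrom]
    simpa [countMachine, h] using ih

theorem countMachine_evalFrom_drop {σ : Type*} [DecidableEq σ] (v x : List σ) (k : ℕ) :
    ∀ (i : ℕ) (hi : i < v.length + 1), i + (k + 1) = v.length →
      (countMachine v).evalFrom ⟨i, hi⟩ (v.drop i ++ x) =
        () :: (countMachine v).evalFrom 0 x := by
  induction k with
  | zero =>
    intro i hi h
    have h' : i < v.length := by omega
    have hd : v.drop (i + 1) = [] := List.drop_eq_nil_of_le (by omega)
    rw [List.drop_eq_getElem_cons h', hd]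
    simp only [List.cons_append, List.nil_append, GenSeqMachine.evalFrom]
    simp [countMachine, h', show i + 1 = v.length by omega]
  | succ k ih =>
    intro i hi h
    have h' : i < v.length := by omega
    have h2 : i + 1 ≠ v.length := by omega
    rw [List.drop_eq_getElem_cons h', List.cons_append, GenSeqMachine.evalFrom,
      ← ih (i + 1) (by omega) (by omega)]
    simp [countMachine, h', h2]

/-- The input ends or mismatches before the current copy is complete; a mismatch leads to the silent
sink. -/
theorem countMachine_evalFrom_of_not_prefix {σ : Type*} [DecidableEq σ] (v x : List σ) :
    ∀ (i : ℕ) (hi : i < v.length + 1), ¬ v.drop i <+: x →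
      (countMachine v).evalFrom ⟨i, hi⟩ x = [] := by
  induction x with
  | nil => intros; rfl
  | cons a x ih =>
    intro i hi h
    have h' : i < v.length := by
      by_contra hc
      exact h (by rw [List.drop_eq_nil_of_le (by omega)]; exact List.nil_prefix)
    rw [List.drop_eq_getElem_cons h', List.cons_prefix_cons, not_and] at h
    rw [GenSeqMachine.evalFrom]
    by_cases ha : v[i] = a
    · have h2 : i + 1 ≠ v.length := fun hc =>
        h ha (by rw [List.drop_eq_nil_of_le hc.ge]; exact List.nil_prefix)
      have := ih (i + 1) (by omega) (h ha)
      simpa [countMachine, h', ha, h2] using this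
    · have := countMachine_evalFrom_last v x
      simpa [countMachine, h', ha] using this

/-- A map that strips leading copies of `v` one at a time tests for powers of `v`. -/
theorem le_length_iff_wordPow_prefix {σ : Type*} {v : List σ} {f : List σ → List Unit}
    (h1 : ∀ y, f (v ++ y) = () :: f y) (h2 : ∀ x, ¬ v <+: x → f x = []) (n : ℕ) :
    ∀ y, n ≤ (f y).length ↔ wordPow v n <+: y := by
  induction n with
  | zero => simp [wordPow]
  | succ n ih =>
    intro y
    by_cases h : v <+: y
    · obtain ⟨y, rfl⟩ := h
      rw [h1, wordPow_succ, List.prefix_append_right_inj, List.length_cons, ← ih]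
      omega
    · rw [h2 y h, wordPow_succ]
      refine iff_of_false (by simp) fun h' => h ((List.prefix_append _ _).trans h')

theorem infinite_image_iff_length_unbounded {α : Type*} (f : α → List Unit) (S : Set α) :
    (f '' S).Infinite ↔ ∀ n, ∃ y ∈ S, n ≤ (f y).length := by
  have hinj : Function.Injective (List.length : List Unit → ℕ) :=
    List.length_injective_iff.mpr inferInstance
  rw [← Set.infinite_image_iff hinj.injOn, Set.image_image, Set.infinite_iff_exists_gt]
  constructor
  · intro h n
    obtain ⟨_, ⟨y, hy, rfl⟩, h⟩ := h n
    exact ⟨y, hy, h.le⟩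
  · intro h n
    obtain ⟨y, hy, h⟩ := h (n + 1)
    exact ⟨_, ⟨y, hy, rfl⟩, h⟩

theorem exists_genSeqMapping_isLimitOf_iff {σ : Type*} (v : List σ) (hv : v ≠ []) :
    ∃ f : List σ → List Unit, IsGenSeqMapping f ∧
      (∀ y, f (v ++ y) = () :: f y) ∧
      (∀ x, ¬ v <+: x → f x = []) ∧
      ∀ (L : Language σ) (u : List σ),
        IsLimitOf (regularWord u v hv) L ↔
          Set.Infinite (f '' {y : List σ | y ∈ L.leftQuotient u}) := by
  classical
  have hl : 0 < v.length := List.length_pos_iff.mpr hv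
  have h1 : ∀ y, (countMachine v).evalFrom 0 (v ++ y) = () :: (countMachine v).evalFrom 0 y :=
    fun y => countMachine_evalFrom_drop v y (v.length - 1) 0 (by omega) (by omega)
  have h2 : ∀ x, ¬ v <+: x → (countMachine v).evalFrom 0 x = [] :=
    fun x hx => countMachine_evalFrom_of_not_prefix v x 0 (by omega) hx
  refine ⟨(countMachine v).evalFrom 0, ⟨_, inferInstance, countMachine v, fun _ => rfl⟩,
    h1, h2, fun L u => ?_⟩
  rw [isLimitOf_regularWord_iff, infinite_image_iff_length_unbounded]
  refine forall_congr' fun n => ?_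
  simp only [le_length_iff_wordPow_prefix h1 h2]
  constructor
  · rintro ⟨x, hx, y, rfl⟩
    exact ⟨wordPow v n ++ y, by simpa [Language.mem_leftQuotient] using hx,
      List.prefix_append _ _⟩
  · rintro ⟨y, hy, hp⟩
    exact ⟨u ++ y, hy, (List.prefix_append_right_inj u).mpr hp⟩

/-! ### Words generated by a list of productions -/

/-- Sentential forms over numbered symbols: `Sum.inl` for terminals, `Sum.inr` for nonterminals. -/
abbrev CodeForm : Type := List (ℕ ⊕ ℕ)

/-- Lists of productions over numbered symbols. -/
abbrev CodeRules : Type := List (ℕ × CodeForm)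

/-- `Yields R s x`: the terminal word `x` is derivable from the sentential form `s`. -/
inductive Yields (R : CodeRules) : CodeForm → List ℕ → Prop
  | nil : Yields R [] []
  | terminal {s x} (a : ℕ) (h : Yields R s x) : Yields R (Sum.inl a :: s) (a :: x)
  | nonterminal {A α s x y} (hr : (A, α) ∈ R) (hα : Yields R α x) (hs : Yields R s y) :
      Yields R (Sum.inr A :: s) (x ++ y)

theorem Yields.append {R : CodeRules} {s t : CodeForm} {x y : List ℕ} (hs : Yields R s x)
    (ht : Yields R t y) : Yields R (s ++ t) (x ++ y) := by
  induction hs with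
  | nil => exact ht
  | terminal a _ ih => exact ih.terminal a
  | nonterminal hr hα _ _ ih =>
    rw [List.append_assoc]
    exact Yields.nonterminal hr hα ih

theorem Yields.exists_of_append {R : CodeRules} {s t : CodeForm} {z : List ℕ}
    (h : Yields R (s ++ t) z) : ∃ x y, z = x ++ y ∧ Yields R s x ∧ Yields R t y := by
  induction s generalizing z with
  | nil => exact ⟨[], z, rfl, .nil, h⟩
  | cons b s ih =>
    cases h with
    | terminal a h =>
      obtain ⟨x, y, rfl, hx, hy⟩ := ih h
      exact ⟨a :: x, y, rfl, hx.terminal a, hy⟩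
    | @nonterminal A α _ x₁ _ hr hα h =>
      obtain ⟨x, y, rfl, hx, hy⟩ := ih h
      exact ⟨x₁ ++ x, y, by simp, .nonterminal hr hα hx, hy⟩

theorem Yields.map_inl (R : CodeRules) (x : List ℕ) : Yields R (x.map Sum.inl) x := by
  induction x with
  | nil => exact .nil
  | cons a x ih => exact ih.terminal a

theorem yields_singleton {R : CodeRules} {A : ℕ} {α : CodeForm} {x : List ℕ} (hr : (A, α) ∈ R)
    (h : Yields R α x) : Yields R [Sum.inr A] x := by
  simpa using h.nonterminal hr .nil

/-! ### Pumping for weighted runs of automata on derivable words -/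

section Weights

variable {Q : Type*} (R : CodeRules) (δ : Q → ℕ → Q) (κ : Q → ℕ → ℕ)

/-- The total weight of the transitions of the run on a word. -/
def runWeight : Q → List ℕ → ℕ
  | _, [] => 0
  | p, a :: x => κ p a + runWeight (δ p a) x

theorem runWeight_append (p : Q) (x y : List ℕ) :
    runWeight δ κ p (x ++ y) = runWeight δ κ p x + runWeight δ κ (x.foldl δ p) y := by
  induction x generalizing p with
  | nil => simp [runWeight]
  | cons a x ih => simp [runWeight, ih, add_assoc]

/-- Some word derivable from `s` has a run from `p` to `q` of weight `n`. -/
def HasRun (s : CodeForm) (p : Q) (n : ℕ) (q : Q) : Prop :=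
  ∃ x, Yields R s x ∧ runWeight δ κ p x = n ∧ x.foldl δ p = q

/-- The weights of the runs from `p` to `q` on words derivable from `s` are unbounded. -/
def UnboundedRuns (s : CodeForm) (p q : Q) : Prop :=
  ∀ n, ∃ m, n ≤ m ∧ HasRun R δ κ s p m q

variable {R δ κ}

theorem HasRun.terminal {s : CodeForm} {p q : Q} {n : ℕ} (a : ℕ)
    (h : HasRun R δ κ s (δ p a) n q) : HasRun R δ κ (Sum.inl a :: s) p (κ p a + n) q := by
  obtain ⟨x, hx, rfl, rfl⟩ := h
  exact ⟨a :: x, hx.terminal a, rfl, rfl⟩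

theorem HasRun.nonterminal {s α : CodeForm} {p q r : Q} {A n m : ℕ} (hr : (A, α) ∈ R)
    (hα : HasRun R δ κ α p n r) (hs : HasRun R δ κ s r m q) :
    HasRun R δ κ (Sum.inr A :: s) p (n + m) q := by
  obtain ⟨x, hx, rfl, rfl⟩ := hα
  obtain ⟨y, hy, rfl, rfl⟩ := hs
  exact ⟨x ++ y, hx.nonterminal hr hy, runWeight_append .., List.foldl_append⟩

theorem HasRun.cons_of_singleton {s : CodeForm} {p q r : Q} {A n m : ℕ}
    (hA : HasRun R δ κ [Sum.inr A] p n r) (hs : HasRun R δ κ s r m q) :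
    HasRun R δ κ (Sum.inr A :: s) p (n + m) q := by
  obtain ⟨x, hx, rfl, rfl⟩ := hA
  obtain ⟨y, hy, rfl, rfl⟩ := hs
  exact ⟨x ++ y, hx.append hy, runWeight_append .., List.foldl_append⟩

theorem HasRun.singleton {α : CodeForm} {p r : Q} {A n : ℕ} (hr : (A, α) ∈ R)
    (hα : HasRun R δ κ α p n r) : HasRun R δ κ [Sum.inr A] p n r := by
  obtain ⟨x, hx, h⟩ := hα
  exact ⟨x, yields_singleton hr hx, h⟩

variable (R δ κ) in
/-- Derivations together with a run, in which no path of the derivation tree repeats a triple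
`(A, p, q)` of a nonterminal and the states before and after it, nor meets a triple of `F`. -/
inductive SimpleRun : Set (ℕ × Q × Q) → CodeForm → Q → ℕ → Q → Prop
  | nil (F p) : SimpleRun F [] p 0 p
  | terminal {F s p n q} (a : ℕ) (h : SimpleRun F s (δ p a) n q) :
      SimpleRun F (Sum.inl a :: s) p (κ p a + n) q
  | nonterminal {F A α s p n r m q} (hr : (A, α) ∈ R) (hF : (A, p, r) ∉ F)
      (hα : SimpleRun (insert (A, p, r) F) α p n r) (hs : SimpleRun F s r m q) :
      SimpleRun F (Sum.inr A :: s) p (n + m) q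

theorem SimpleRun.hasRun {F : Set (ℕ × Q × Q)} {s : CodeForm} {p q : Q} {n : ℕ}
    (h : SimpleRun R δ κ F s p n q) : HasRun R δ κ s p n q := by
  induction h with
  | nil F p => exact ⟨[], .nil, rfl, rfl⟩
  | terminal a _ ih => exact ih.terminal a
  | nonterminal hr _ _ _ ih₁ ih₂ => exact ih₁.nonterminal hr ih₂

theorem SimpleRun.mono {F F' : Set (ℕ × Q × Q)} {s : CodeForm} {p q : Q} {n : ℕ}
    (h : SimpleRun R δ κ F s p n q) (hF : F' ⊆ F) : SimpleRun R δ κ F' s p n q := by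
  induction h generalizing F' with
  | nil F p => exact .nil _ _
  | terminal a _ ih => exact (ih hF).terminal a
  | nonterminal hr hn _ _ ih₁ ih₂ =>
    exact .nonterminal hr (fun h => hn (hF h)) (ih₁ (Set.insert_subset_insert hF)) (ih₂ hF)

theorem SimpleRun.cons_of_singleton {F : Set (ℕ × Q × Q)} {s : CodeForm} {p q r : Q}
    {A n m : ℕ} (hA : SimpleRun R δ κ F [Sum.inr A] p n r) (hs : SimpleRun R δ κ F s r m q) :
    SimpleRun R δ κ F (Sum.inr A :: s) p (n + m) q := by
  cases hA with
  | nonterminal hr hF hα hnil =>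
    cases hnil
    exact .nonterminal hr hF hα hs

/-- Either a simple run avoids a triple, or it runs through it, and then the part between can be
exchanged. -/
theorem SimpleRun.insert_or_context {F : Set (ℕ × Q × Q)} {s : CodeForm} {p q : Q} {n : ℕ}
    (h : SimpleRun R δ κ F s p n q) (A : ℕ) (p₁ q₁ : Q) :
    SimpleRun R δ κ (insert (A, p₁, q₁) F) s p n q ∨
      ∃ k m, n = k + m ∧ SimpleRun R δ κ F [Sum.inr A] p₁ m q₁ ∧
        ∀ m', HasRun R δ κ [Sum.inr A] p₁ m' q₁ → HasRun R δ κ s p (k + m') q := by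
  induction h with
  | nil F p => exact .inl (.nil _ _)
  | @terminal F s p n q a _ ih =>
    rcases ih with ih | ⟨k, m, rfl, hA, hc⟩
    · exact .inl (ih.terminal a)
    · refine .inr ⟨κ p a + k, m, by omega, hA, fun m' h' => ?_⟩
      rw [add_assoc]
      exact (hc m' h').terminal a
  | @nonterminal F B α s p n r m q hr hF hα hs ih₁ ih₂ =>
    by_cases ht : (B, p, r) = (A, p₁, q₁)
    -- The triple is at the root of the first tree, so the context contributes only the weight `m`
    -- of the rest of the form.
    · obtain ⟨rfl, rfl, rfl⟩ : B = A ∧ p = p₁ ∧ r = q₁ := by simpa using ht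
      refine .inr ⟨m, n, by omega, ?_, fun m' h' => ?_⟩
      · simpa using SimpleRun.nonterminal hr hF hα (.nil F r)
      · rw [add_comm]
        exact h'.cons_of_singleton hs.hasRun
    · rcases ih₁ with ih₁ | ⟨k, l, rfl, hA, hc⟩
      · rcases ih₂ with ih₂ | ⟨k, l, rfl, hA, hc⟩
        · refine .inl (.nonterminal hr ?_ (Set.insert_comm _ _ _ ▸ ih₁) ih₂)
          simp only [Set.mem_insert_iff, not_or]
          exact ⟨ht, hF⟩
        · refine .inr ⟨n + k, l, by omega, hA, fun m' h' => ?_⟩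
          rw [add_assoc]
          exact hα.hasRun.nonterminal hr (hc m' h')
      · refine .inr ⟨k + m, l, by omega, hA.mono (Set.subset_insert _ _), fun m' h' => ?_⟩
        rw [add_right_comm]
        exact (hc m' h').nonterminal hr hs.hasRun

/-- A repeated triple either adds no weight, and the outer occurrence can be replaced by the inner
one, or adds positive weight, and can be pumped. The end state is kept in both cases. -/
theorem Yields.simpleRun_or_unboundedRuns {s : CodeForm} {x : List ℕ} (h : Yields R s x) (p : Q) :
    SimpleRun R δ κ ∅ s p (runWeight δ κ p x) (x.foldl δ p) ∨
      UnboundedRuns R δ κ s p (x.foldl δ p) := by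
  induction h generalizing p with
  | nil => exact .inl (.nil _ _)
  | terminal a _ ih =>
    rcases ih (δ p a) with ih | ih
    · exact .inl (ih.terminal a)
    · refine .inr fun n => ?_
      obtain ⟨m, hm, h⟩ := ih n
      exact ⟨_, hm.trans (Nat.le_add_left _ _), h.terminal a⟩
  | @nonterminal A α s x y hr hα hs ih₁ ih₂ =>
    rw [runWeight_append, List.foldl_append]
    have hy : HasRun R δ κ s (x.foldl δ p) _ _ := ⟨y, hs, rfl, rfl⟩
    have key : UnboundedRuns R δ κ [Sum.inr A] p (x.foldl δ p) →
        UnboundedRuns R δ κ (Sum.inr A :: s) p (y.foldl δ (x.foldl δ p)) := fun hu n => by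
      obtain ⟨m, hm, h⟩ := hu n
      exact ⟨_, hm.trans (Nat.le_add_right _ _), h.cons_of_singleton hy⟩
    rcases ih₂ (x.foldl δ p) with ih₂ | ih₂
    · rcases ih₁ p with ih₁ | ih₁
      · rcases ih₁.insert_or_context A p (x.foldl δ p) with h | ⟨k, m, hkm, hA, hc⟩
        · exact .inl (.nonterminal hr (Set.notMem_empty _) h ih₂)
        -- `k` is the weight of the part between the root triple and its repetition below; for `k >
        -- 0`, each further nesting of that part adds `k`.
        · rcases Nat.eq_zero_or_pos k with rfl | hk
          · rw [hkm, zero_add]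
            exact .inl (hA.cons_of_singleton ih₂)
          · refine .inr (key fun n => ?_)
            induction n with
            | zero => exact ⟨m, Nat.zero_le _, hA.hasRun⟩
            | succ n ih =>
              obtain ⟨l, hl, h⟩ := ih
              exact ⟨k + l, by omega, (hc l h).singleton hr⟩
      · refine .inr (key fun n => ?_)
        obtain ⟨m, hm, h⟩ := ih₁ n
        exact ⟨m, hm, h.singleton hr⟩
    · refine .inr fun n => ?_
      obtain ⟨m, hm, h⟩ := ih₂ n
      exact ⟨_, hm.trans (Nat.le_add_left _ _), HasRun.nonterminal hr ⟨x, hα, rfl, rfl⟩ h⟩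

/-- Each expansion of a nonterminal uses up one of the finitely many triples and branches at most
`M`-fold, so the tree has bounded depth and boundedly many leaves, each of weight at most 1. -/
theorem SimpleRun.mem_and_le [DecidableEq Q] {U : Finset Q} (hU : ∀ p ∈ U, ∀ a, δ p a ∈ U)
    (hκ : ∀ p a, κ p a ≤ 1) {V : Finset ℕ} {M : ℕ} (hR : ∀ ρ ∈ R, ρ.1 ∈ V ∧ ρ.2.length ≤ M)
    (hM : 1 ≤ M) {F : Set (ℕ × Q × Q)} {s : CodeForm} {p q : Q} {n : ℕ}
    (h : SimpleRun R δ κ F s p n q) :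
    p ∈ U → q ∈ U ∧ ∀ F' : Finset (ℕ × Q × Q), (F' : Set _) = F →
      n ≤ s.length * M ^ ((V ×ˢ U ×ˢ U) \ F').card := by
  induction h with
  | nil F p => exact fun hp => ⟨hp, fun _ _ => Nat.zero_le _⟩
  | @terminal F s p n q a _ ih =>
    intro hp
    obtain ⟨hq, ih⟩ := ih (hU p hp a)
    refine ⟨hq, fun F' hF' => ?_⟩
    have h1 := ih F' hF'
    have h2 := Nat.one_le_pow ((V ×ˢ U ×ˢ U) \ F').card M hM
    have h3 := hκ p a
    rw [List.length_cons, add_mul]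
    omega
  | @nonterminal F A α s p n r m q hr hF _ _ ih₁ ih₂ =>
    intro hp
    obtain ⟨hr', ih₁⟩ := ih₁ hp
    obtain ⟨hq, ih₂⟩ := ih₂ hr'
    refine ⟨hq, fun F' hF' => ?_⟩
    have h1 := ih₁ (insert (A, p, r) F') (by rw [Finset.coe_insert, hF'])
    have h2 := ih₂ F' hF'
    have hmem : (A, p, r) ∈ (V ×ˢ U ×ˢ U) \ F' := by
      rw [← hF', Finset.mem_coe] at hF
      simp [hF, (hR _ hr).1, hp, hr']
    have h3 : ((V ×ˢ U ×ˢ U) \ insert (A, p, r) F').card + 1 = ((V ×ˢ U ×ˢ U) \ F').card := by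
      rw [Finset.sdiff_insert, Finset.card_erase_add_one hmem]
    rw [← h3, pow_succ'] at h2 ⊢
    have h4 := Nat.mul_le_mul_right (M ^ ((V ×ˢ U ×ˢ U) \ insert (A, p, r) F').card) (hR _ hr).2
    rw [List.length_cons, add_mul]
    dsimp only at h4
    omega

/-- A run of large weight on a derivable word can be pumped. -/
theorem Yields.unboundedRuns [DecidableEq Q] {U : Finset Q} (hU : ∀ p ∈ U, ∀ a, δ p a ∈ U)
    (hκ : ∀ p a, κ p a ≤ 1) {V : Finset ℕ} {M : ℕ} (hR : ∀ ρ ∈ R, ρ.1 ∈ V ∧ ρ.2.length ≤ M)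
    (hM : 1 ≤ M) {A : ℕ} {x : List ℕ} (h : Yields R [Sum.inr A] x) {p : Q} (hp : p ∈ U)
    (hx : M ^ (V.card * (U.card * U.card)) < runWeight δ κ p x) :
    UnboundedRuns R δ κ [Sum.inr A] p (x.foldl δ p) := by
  refine (h.simpleRun_or_unboundedRuns p).resolve_left fun h => ?_
  have := (h.mem_and_le hU hκ hR hM hp).2 ∅ (by simp)
  simp only [Finset.sdiff_empty, Finset.card_product, List.length_singleton, one_mul] at this
  omega

end Weights

/-! ### The length of the longest common prefix with an `ω`-word -/

/-- Follow an `ω`-word as long as the letters read agree with it. -/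
def followStep : Option (Stream' ℕ) → ℕ → Option (Stream' ℕ)
  | none, _ => none
  | some w, a => if w.head = a then some w.tail else none

/-- Count the letters that agree with an `ω`-word. -/
def followWeight : Option (Stream' ℕ) → ℕ → ℕ
  | none, _ => 0
  | some w, a => if w.head = a then 1 else 0

theorem runWeight_none (x : List ℕ) : runWeight followStep followWeight none x = 0 := by
  induction x with
  | nil => rfl
  | cons a x ih => simpa [runWeight, followStep, followWeight] using ih

/-- After the first mismatch the run stays in `none` at weight 0, so the total weight is the length
of the longest common prefix. -/
theorem le_runWeight_some_iff (n : ℕ) (w : Stream' ℕ) (x : List ℕ) :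
    n ≤ runWeight followStep followWeight (some w) x ↔ w.take n <+: x := by
  induction x generalizing n w with
  | nil => cases n <;> simp [runWeight, Stream'.take_succ]
  | cons a x ih =>
    cases n with
    | zero => simp
    | succ n =>
      rw [Stream'.take_succ, List.cons_prefix_cons, ← ih]
      by_cases h : w.head = a
      · simp only [runWeight, followStep, followWeight, h, if_true, true_and]
        omega
      · simp [runWeight, followStep, followWeight, h, runWeight_none]

open Classical in
/-- The states reached within `n` letters when following an `ω`-word. -/
noncomputable def followStates (w : Stream' ℕ) (n : ℕ) : Finset (Option (Stream' ℕ)) :=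
  insert none ((Finset.range n).image fun i => some (w.drop i))

theorem card_followStates_le (w : Stream' ℕ) (n : ℕ) : (followStates w n).card ≤ n + 1 := by
  classical
  refine (Finset.card_insert_le _ _).trans (Nat.succ_le_succ ?_)
  exact Finset.card_image_le.trans (Finset.card_range n).le

theorem followStep_mem_followStates {w : Stream' ℕ} {k n : ℕ} (hk : k < n)
    (hw : w.drop n = w.drop k) : ∀ p ∈ followStates w n, ∀ a, followStep p a ∈ followStates w n := by
  classical
  intro p hp a
  simp only [followStates, Finset.mem_insert, Finset.mem_image, Finset.mem_range] at hp ⊢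
  rcases hp with rfl | ⟨i, hi, rfl⟩
  · exact .inl rfl
  · rw [followStep]
    split_ifs with h
    · refine .inr ?_
      rw [Stream'.tail_drop']
      -- From the last listed suffix, periodicity leads back to the `k`-th.
      rcases (Nat.succ_le_of_lt hi).lt_or_eq with h' | h'
      · exact ⟨i + 1, h', rfl⟩
      · exact ⟨k, hk, by rw [← hw, ← h']⟩
    · exact .inl rfl

/-- An exponent from which on a prefix `u v ^ n` of a derivable word can be pumped, where `l` is the
length of `u v`. -/
def pumpBound (R : CodeRules) (l : ℕ) : ℕ :=
  -- The base bounds every right-hand side and is positive. The exponent bounds the number of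
  -- triples: left-hand sides, and twice the `l` suffixes of `u v^ω` together with the state `none`.
  -- The last `+ 1` makes the excess strict.
  ((R.flatMap Prod.snd).length + 1) ^ (R.length * ((l + 1) * (l + 1))) + 1

theorem length_le_length_flatMap_snd {R : CodeRules} {ρ : ℕ × CodeForm} (h : ρ ∈ R) :
    ρ.2.length ≤ (R.flatMap Prod.snd).length := by
  rw [List.length_flatMap]
  exact List.le_sum_of_mem (List.mem_map_of_mem (f := fun ρ => ρ.2.length) h)

theorem forall_exists_wordPow_prefix {R : CodeRules} {A : ℕ} {u v x : List ℕ} (hv : v ≠ [])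
    (h : Yields R [Sum.inr A] x)
    (hx : u ++ wordPow v (pumpBound R (u.length + v.length)) <+: x) (n : ℕ) :
    ∃ y, Yields R [Sum.inr A] y ∧ u ++ wordPow v n <+: y := by
  classical
  have htake (n : ℕ) : (regularWord u v hv).take (u ++ wordPow v n).length = u ++ wordPow v n := by
    rw [regularWord_eq_append u hv n, take_length_append_stream]
  have hdrop (n : ℕ) :
      (regularWord u v hv).drop (u ++ wordPow v n).length = Stream'.cycle v hv := by
    rw [regularWord_eq_append u hv n, Stream'.drop_append_stream]
  set w := regularWord u v hv
  set l := u.length + v.length with hl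
  have hlv : 0 < v.length := List.length_pos_iff.mpr hv
  have hper : w.drop l = w.drop u.length := by
    have h0 := hdrop 0
    have h1 := hdrop 1
    simp only [List.length_append, length_wordPow, zero_mul, one_mul, add_zero] at h0 h1
    rw [hl, h0, h1]
  have hlen : pumpBound R l ≤ runWeight followStep followWeight (some w) x := by
    refine (le_length_wordPow hv _).trans ((Nat.le_add_left _ u.length).trans ?_)
    rw [← List.length_append, le_runWeight_some_iff, htake]
    exact hx
  have hun := h.unboundedRuns (κ := followWeight) (U := followStates w l)
    (V := (R.map Prod.fst).toFinset) (M := (R.flatMap Prod.snd).length + 1) (p := some w)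
    (followStep_mem_followStates (k := u.length) (by omega) hper)
    (by rintro (_ | w) a <;> simp only [followWeight] <;> first | omega | (split_ifs <;> omega))
    (fun ρ hρ => ⟨by simpa using ⟨ρ.2, hρ⟩,
      (length_le_length_flatMap_snd hρ).trans (Nat.le_succ _)⟩)
    (Nat.le_add_left _ _)
    (by
      simp only [followStates, Finset.mem_insert, Finset.mem_image, Finset.mem_range]
      exact .inr ⟨0, by omega, rfl⟩)
    (by
      refine lt_of_lt_of_le (Nat.lt_succ_of_le ?_) hlen
      refine Nat.pow_le_pow_right (Nat.le_add_left _ _) (Nat.mul_le_mul ?_ ?_)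
      · exact (List.toFinset_card_le _).trans (List.length_map _).le
      · exact Nat.mul_le_mul (card_followStates_le w l) (card_followStates_le w l))
  -- A weight of at least this length forces agreement with `u v^ω` throughout `u v^n`.
  obtain ⟨m, hm, y, hy, rfl, -⟩ := hun (u ++ wordPow v n).length
  rw [le_runWeight_some_iff, htake] at hm
  exact ⟨y, hy, hm⟩

/-! ### Certificates for derivability -/

open Classical in
/-- Apply the production `t.2.1` between the sentential forms `t.1` and `t.2.2`, if possible. -/
noncomputable def applyProduction (R : CodeRules) (s : CodeForm)
    (t : CodeForm × (ℕ × CodeForm) × CodeForm) : CodeForm :=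
  -- An inapplicable step changes nothing, so no list of steps can certify a false derivation.
  if t.2.1 ∈ R ∧ s = t.1 ++ Sum.inr t.2.1.1 :: t.2.2 then t.1 ++ (t.2.1.2 ++ t.2.2) else s

theorem Yields.exists_foldl_applyProduction {R : CodeRules} {s : CodeForm} {x : List ℕ}
    (h : Yields R s x) (l r : CodeForm) :
    ∃ ts, List.foldl (applyProduction R) (l ++ (s ++ r)) ts = l ++ (x.map Sum.inl ++ r) := by
  induction h generalizing l r with
  | nil => exact ⟨[], rfl⟩
  | terminal a _ ih =>
    obtain ⟨ts, h⟩ := ih (l ++ [Sum.inl a]) r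
    exact ⟨ts, by simpa using h⟩
  | @nonterminal A α s x y hr _ _ ih₁ ih₂ =>
    obtain ⟨ts₁, h₁⟩ := ih₁ l (s ++ r)
    obtain ⟨ts₂, h₂⟩ := ih₂ (l ++ x.map Sum.inl) r
    refine ⟨(l, (A, α), s ++ r) :: (ts₁ ++ ts₂), ?_⟩
    rw [List.foldl_cons, List.foldl_append, applyProduction, if_pos ⟨hr, rfl⟩]
    simp only [List.append_assoc, List.map_append] at h₁ h₂ ⊢
    rw [h₁, h₂]

theorem Yields.of_applyProduction {R : CodeRules} {s : CodeForm} {x : List ℕ}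
    (t : CodeForm × (ℕ × CodeForm) × CodeForm) (h : Yields R (applyProduction R s t) x) :
    Yields R s x := by
  obtain ⟨l, ⟨A, α⟩, r⟩ := t
  rw [applyProduction] at h
  split_ifs at h with ht
  · obtain ⟨hr, rfl⟩ := ht
    obtain ⟨x, y, rfl, hx, hy⟩ := h.exists_of_append
    obtain ⟨y, z, rfl, hy, hz⟩ := hy.exists_of_append
    exact hx.append (hy.nonterminal hr hz)
  · exact h

theorem yields_iff_exists_foldl {R : CodeRules} {s : CodeForm} {x : List ℕ} :
    Yields R s x ↔ ∃ ts, List.foldl (applyProduction R) s ts = x.map Sum.inl := by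
  constructor
  · intro h
    simpa using h.exists_foldl_applyProduction [] []
  · rintro ⟨ts, h⟩
    have key : Yields R (ts.foldl (applyProduction R) s) x := h ▸ Yields.map_inl R x
    clear h
    induction ts generalizing s with
    | nil => exact key
    | cons t ts ih => exact (ih key).of_applyProduction t

/-! ### Certificates for underivability -/

/-- Reading `x` against the expected word `p` leaves `q`; once nothing is expected, any letter may
be read. -/
def Scan : List ℕ → List ℕ → List ℕ → Prop
  | p, [], q => p = q
  | p, a :: x, q => (p = [] ∨ p.head? = some a) ∧ Scan p.tail x q

theorem scan_append {p x y q : List ℕ} :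
    Scan p (x ++ y) q ↔ ∃ r, Scan p x r ∧ Scan r y q := by
  induction x generalizing p with
  | nil => simp [Scan]
  | cons a x ih => simp [Scan, ih, and_assoc]

theorem scan_nil_iff {p x : List ℕ} : Scan p x [] ↔ p <+: x := by
  induction x generalizing p with
  | nil => simp [Scan]
  | cons a x ih =>
    cases p with
    | nil => simp [Scan, ih]
    | cons b p => simp [Scan, ih, List.cons_prefix_cons]

theorem Scan.mem {U : List (List ℕ)} (hU : ∀ p ∈ U, p.tail ∈ U) {p x q : List ℕ}
    (h : Scan p x q) (hp : p ∈ U) : q ∈ U := by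
  induction x generalizing p with
  | nil => exact (show p = q from h) ▸ hp
  | cons a x ih => exact ih h.2 (hU p hp)

/-- The first symbol of a sentential form, if it is a terminal. -/
def headLetter (s : CodeForm) : Option ℕ := s.head?.bind Sum.getLeft?

/-- Certificates: a list of sentential forms, a list of words, and a list of triples of a sentential
form and two words. -/
abbrev ScanCertificate : Type :=
  List CodeForm × List (List ℕ) × List (CodeForm × List ℕ × List ℕ)

/-- The forms and words listed are closed under the productions and under tails, and the triples
listed are closed under scanning, without showing that `A` derives a word with prefix `z`. -/
def Refutes (k : ScanCertificate) (R : CodeRules) (A : ℕ) (z : List ℕ) : Prop :=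
  [Sum.inr A] ∈ k.1 ∧ z ∈ k.2.1 ∧ ([Sum.inr A], z, []) ∉ k.2.2 ∧
    (∀ ρ ∈ R, ρ.2 ∈ k.1) ∧ (∀ s ∈ k.1, s.tail ∈ k.1) ∧ (∀ p ∈ k.2.1, p.tail ∈ k.2.1) ∧
    (∀ p ∈ k.2.1, ([], p, p) ∈ k.2.2) ∧
    -- The closure rules are negated conjunctions, so that primitive recursiveness follows from
    -- closure under Boolean operations and bounded quantifiers.
    (∀ s ∈ k.1, ∀ p ∈ k.2.1, ∀ q ∈ k.2.1,
      ¬ (headLetter s ≠ none ∧ (p = [] ∨ p.head? = headLetter s) ∧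
        (s.tail, p.tail, q) ∈ k.2.2 ∧ (s, p, q) ∉ k.2.2)) ∧
    (∀ s ∈ k.1, ∀ p ∈ k.2.1, ∀ q ∈ k.2.1, ∀ r ∈ k.2.1, ∀ ρ ∈ R,
      ¬ (s.head? = some (Sum.inr ρ.1) ∧ (ρ.2, p, r) ∈ k.2.2 ∧ (s.tail, r, q) ∈ k.2.2 ∧
        (s, p, q) ∉ k.2.2))

/-- By induction on derivations, a closed set of triples contains all true ones over the listed
forms and words; a missing triple is therefore false. -/
theorem Refutes.not_yields {k : ScanCertificate} {R : CodeRules} {A : ℕ} {z : List ℕ}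
    (h : Refutes k R A z) {x : List ℕ} (hx : Yields R [Sum.inr A] x) : ¬ z <+: x := by
  obtain ⟨F, U, T⟩ := k
  obtain ⟨hA, hz, hT, hR, hF, hU, hnil, hterm, hnonterm⟩ := h
  dsimp only at *
  have key : ∀ s x, Yields R s x → s ∈ F → ∀ p ∈ U, ∀ q, Scan p x q → (s, p, q) ∈ T := by
    intro s x h
    induction h with
    | nil =>
      rintro - p hp q rfl
      exact hnil p hp
    | terminal a _ ih =>
      intro hs p hp q hq
      by_contra hc
      exact hterm _ hs p hp q (hq.2.mem hU (hU p hp))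
        ⟨by simp [headLetter], hq.1, ih (hF _ hs) _ (hU p hp) q hq.2, hc⟩
    | nonterminal hr _ _ ih₁ ih₂ =>
      intro hs p hp q hq
      obtain ⟨r, hpr, hrq⟩ := scan_append.mp hq
      have hr' := hpr.mem hU hp
      by_contra hc
      exact hnonterm _ hs p hp q (hrq.mem hU hr') r hr' _ hr
        ⟨rfl, ih₁ (hR _ hr) p hp r hpr, ih₂ (hF _ hs) r hr' q hrq, hc⟩
  exact fun hp => hT (key _ x hx hA z hz [] (scan_nil_iff.mpr hp))

/-- Suffixes of the start form, of the right-hand sides and of `z` are finitely many and closed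
under tails; the true triples over them are closed under scanning. Mere existence is needed, so
truth may be filtered classically. -/
theorem exists_refutes {R : CodeRules} {A : ℕ} {z : List ℕ}
    (h : ∀ x, Yields R [Sum.inr A] x → ¬ z <+: x) : ∃ k, Refutes k R A z := by
  classical
  let F : List CodeForm := ([Sum.inr A] :: R.map Prod.snd).flatMap List.tails
  let U : List (List ℕ) := z.tails
  let T : List (CodeForm × List ℕ × List ℕ) :=
    (F.product (U.product U)).filter fun t => ∃ x, Yields R t.1 x ∧ Scan t.2.1 x t.2.2
  have hT (s p q) : (s, p, q) ∈ T ↔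
      (s ∈ F ∧ p ∈ U ∧ q ∈ U) ∧ ∃ x, Yields R s x ∧ Scan p x q := by
    simp [T, List.mem_filter]
  have htail {α : Type} {l m : List α} (h : l <:+ m) : l.tail <:+ m :=
    (List.tail_suffix l).trans h
  have hF (s : CodeForm) : s ∈ F ↔ ∃ t ∈ [Sum.inr A] :: R.map Prod.snd, s <:+ t := by
    simp only [F, List.mem_flatMap, List.mem_tails]
  have hU (p : List ℕ) : p ∈ U ↔ p <:+ z := List.mem_tails _ _
  refine ⟨(F, U, T), ?_, ?_, ?_, ?_, ?_, ?_, ?_, ?_, ?_⟩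
  · exact (hF _).mpr ⟨_, List.mem_cons_self, List.suffix_rfl⟩
  · exact (hU z).mpr List.suffix_rfl
  · rw [hT]
    rintro ⟨-, x, hx, hs⟩
    exact h x hx (scan_nil_iff.mp hs)
  · exact fun ρ hρ => (hF _).mpr
      ⟨_, List.mem_cons_of_mem _ (List.mem_map_of_mem hρ), List.suffix_rfl⟩
  · intro s hs
    obtain ⟨t, ht, hs⟩ := (hF s).mp hs
    exact (hF _).mpr ⟨t, ht, htail hs⟩
  · exact fun p hp => (hU _).mpr (htail ((hU p).mp hp))
  · exact fun p hp => (hT ..).mpr ⟨⟨(hF _).mpr ⟨_, List.mem_cons_self, List.nil_suffix⟩, hp, hp⟩,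
      [], .nil, rfl⟩
  · rintro s hs p hp q hq ⟨h1, h2, h3, h4⟩
    obtain ⟨-, x, hx, hsc⟩ := (hT ..).mp h3
    refine h4 ((hT ..).mpr ⟨⟨hs, hp, hq⟩, ?_⟩)
    rcases s with _ | ⟨a | B, s⟩
    · simp [headLetter] at h1
    · exact ⟨a :: x, hx.terminal a, h2, hsc⟩
    · simp [headLetter] at h1
  · rintro s hs p hp q hq r - ρ hρ ⟨h1, h2, h3, h4⟩
    obtain ⟨-, x, hx, hsx⟩ := (hT ..).mp h2
    obtain ⟨-, y, hy, hsy⟩ := (hT ..).mp h3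
    refine h4 ((hT ..).mpr ⟨⟨hs, hp, hq⟩, ?_⟩)
    rcases s with _ | ⟨b, s⟩
    · simp at h1
    · obtain rfl : b = Sum.inr ρ.1 := by simpa using h1
      exact ⟨x ++ y, hx.nonterminal hρ hy, scan_append.mpr ⟨r, hsx, hsy⟩⟩

/-! ### Computability of the certificates -/

section Computability

open Primrec

variable {α β : Type*} [Primcodable α] [Primcodable β]

/-- Unbounded search through the codes of `β` finds a witness if there is one. -/
theorem REPred.exists_of_primrecRel {p : α → β → Prop} (hp : PrimrecRel p) :
    REPred fun a => ∃ b, p a b := by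
  classical
  have hg : Primrec₂ fun (a : α) (n : ℕ) =>
      ((Encodable.decode n : Option β).bind fun b => if p a b then some () else none) :=
    option_bind (Primrec.decode.comp snd)
      (Primrec.ite (hp.comp (fst.comp fst) snd) (Primrec.const _) (Primrec.const _))
  refine (Partrec.rfindOpt hg.to_comp).dom_re.of_eq fun a => ?_
  rw [Nat.rfindOpt_dom]
  constructor
  · rintro ⟨n, u, h⟩
    obtain ⟨b, -, hb⟩ := Option.bind_eq_some_iff.mp h
    exact ⟨b, by by_contra hc; simp [hc] at hb⟩
  · rintro ⟨b, hb⟩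
    exact ⟨Encodable.encode b, (), by simp [hb]⟩

theorem PrimrecPred.forall_mem {f : α → List β} {p : α → β → Prop} (hf : Primrec f)
    (hp : PrimrecPred fun t : α × β => p t.1 t.2) : PrimrecPred fun a => ∀ b ∈ f a, p a b :=
  (PrimrecRel.forall_mem_list (R := fun b a => p a b)
    (hp.comp (Primrec.pair snd fst))).comp hf Primrec.id

theorem PrimrecPred.list_mem {f : α → β} {g : α → List β} (hf : Primrec f) (hg : Primrec g) :
    PrimrecPred fun a => f a ∈ g a :=
  ((PrimrecRel.exists_mem_list (R := fun b c : β => b = c) Primrec.eq).comp hg hf).of_eq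
    fun a => by simp

theorem primrec₂_nat_pow : Primrec₂ ((· ^ ·) : ℕ → ℕ → ℕ) :=
  (nat_rec' snd (Primrec.const 1)
    (nat_mul.comp (snd.comp snd) (fst.comp fst)).to₂).of_eq fun ⟨m, n⟩ => by
      induction n with
      | zero => rfl
      | succ n ih => exact (congrArg (· * m) ih).trans (pow_succ m n).symm

theorem primrec₂_wordPow : Primrec₂ (wordPow : List ℕ → ℕ → List ℕ) :=
  (nat_rec' snd (Primrec.const [])
    (list_append.comp (fst.comp fst) (snd.comp snd)).to₂).of_eq fun ⟨v, n⟩ => by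
      induction n with
      | zero => rfl
      | succ n ih => simpa [wordPow_succ] using ih

theorem primrec₂_pumpBound : Primrec₂ pumpBound :=
  nat_add.comp (primrec₂_nat_pow.comp
    (nat_add.comp (list_length.comp (list_flatMap fst (snd.comp snd).to₂)) (Primrec.const 1))
    (nat_mul.comp (list_length.comp fst)
      (nat_mul.comp (nat_add.comp snd (Primrec.const 1)) (nat_add.comp snd (Primrec.const 1)))))
    (Primrec.const 1)

theorem primrec_applyProduction : Primrec fun t :
    CodeRules × CodeForm × CodeForm × (ℕ × CodeForm) × CodeForm =>
      applyProduction t.1 t.2.1 t.2.2 := by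
  classical
  have h1 : Primrec fun t : CodeRules × CodeForm × CodeForm × (ℕ × CodeForm) × CodeForm =>
    t.2.2 := snd.comp snd
  have h2 := fst.comp (snd.comp h1)
  refine Primrec.ite (PrimrecPred.and (PrimrecPred.list_mem h2 fst)
    (Primrec.eq.comp (fst.comp snd) ?_)) ?_ (fst.comp snd)
  · exact list_append.comp (fst.comp h1)
      (list_cons.comp (sumInr.comp (fst.comp h2)) (snd.comp (snd.comp h1)))
  · exact list_append.comp (fst.comp h1) (list_append.comp (snd.comp h2) (snd.comp (snd.comp h1)))

theorem primrec_headLetter : Primrec headLetter := by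
  refine (option_bind (g := fun _ b => Sum.getLeft? b) list_head? ?_).of_eq fun _ => rfl
  exact (sumCasesOn snd (option_some.comp snd).to₂ (Primrec.const none).to₂).of_eq
    fun ⟨_, b⟩ => by cases b <;> rfl

theorem primrecPred_refutes : PrimrecPred fun t : (CodeRules × ℕ × List ℕ) × ScanCertificate =>
    Refutes t.2 t.1.1 t.1.2.1 t.1.2.2 := by
  have hR : Primrec fun t : (CodeRules × ℕ × List ℕ) × ScanCertificate => t.1.1 := fst.comp fst
  have hA : Primrec fun t : (CodeRules × ℕ × List ℕ) × ScanCertificate => t.1.2.1 :=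
    fst.comp (snd.comp fst)
  have hz : Primrec fun t : (CodeRules × ℕ × List ℕ) × ScanCertificate => t.1.2.2 :=
    snd.comp (snd.comp fst)
  have hF : Primrec fun t : (CodeRules × ℕ × List ℕ) × ScanCertificate => t.2.1 := fst.comp snd
  have hU : Primrec fun t : (CodeRules × ℕ × List ℕ) × ScanCertificate => t.2.2.1 :=
    fst.comp (snd.comp snd)
  have hT : Primrec fun t : (CodeRules × ℕ × List ℕ) × ScanCertificate => t.2.2.2 :=
    snd.comp (snd.comp snd)
  have hA' : Primrec fun t : (CodeRules × ℕ × List ℕ) × ScanCertificate =>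
      ([Sum.inr t.1.2.1] : CodeForm) := list_cons.comp (sumInr.comp hA) (Primrec.const [])
  refine .and (.list_mem hA' hF) (.and (.list_mem hz hU) (.and
    (.not (.list_mem (hA'.pair (hz.pair (Primrec.const []))) hT)) (.and
    (.forall_mem hR (.list_mem (snd.comp snd) (hF.comp fst))) (.and
    (.forall_mem hF (.list_mem (list_tail.comp snd) (hF.comp fst))) (.and
    (.forall_mem hU (.list_mem (list_tail.comp snd) (hU.comp fst))) (.and
    (.forall_mem hU (.list_mem ((Primrec.const []).pair (snd.pair snd)) (hT.comp fst))) (.and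
    ?_ ?_)))))))
  · refine .forall_mem hF (.forall_mem (hU.comp fst) (.forall_mem (hU.comp (fst.comp fst))
      (.not ?_)))
    have hs := primrec_headLetter.comp ((snd.comp (fst.comp fst)) : Primrec fun t :
      ((((CodeRules × ℕ × List ℕ) × ScanCertificate) × CodeForm) × List ℕ) × List ℕ => t.1.1.2)
    refine .and (.not (Primrec.eq.comp hs (Primrec.const none))) (.and (.or
      (Primrec.eq.comp (snd.comp fst) (Primrec.const []))
      (Primrec.eq.comp (list_head?.comp (snd.comp fst)) hs)) (.and
      (.list_mem ((list_tail.comp (snd.comp (fst.comp fst))).pair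
        ((list_tail.comp (snd.comp fst)).pair snd)) (hT.comp (fst.comp (fst.comp fst))))
      (.not (.list_mem ((snd.comp (fst.comp fst)).pair ((snd.comp fst).pair snd))
        (hT.comp (fst.comp (fst.comp fst)))))))
  · refine .forall_mem hF (.forall_mem (hU.comp fst) (.forall_mem (hU.comp (fst.comp fst))
      (.forall_mem (hU.comp (fst.comp (fst.comp fst)))
      (.forall_mem (hR.comp (fst.comp (fst.comp (fst.comp fst)))) (.not ?_)))))
    have hT' : Primrec fun t : ((((((CodeRules × ℕ × List ℕ) × ScanCertificate) × CodeForm) ×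
        List ℕ) × List ℕ) × List ℕ) × (ℕ × CodeForm) => t.1.1.1.1.1.2.2.2 :=
      hT.comp (fst.comp (fst.comp (fst.comp (fst.comp fst))))
    have hs : Primrec fun t : ((((((CodeRules × ℕ × List ℕ) × ScanCertificate) × CodeForm) ×
        List ℕ) × List ℕ) × List ℕ) × (ℕ × CodeForm) => t.1.1.1.1.2 :=
      snd.comp (fst.comp (fst.comp (fst.comp fst)))
    have hp : Primrec fun t : ((((((CodeRules × ℕ × List ℕ) × ScanCertificate) × CodeForm) ×
        List ℕ) × List ℕ) × List ℕ) × (ℕ × CodeForm) => t.1.1.1.2 :=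
      snd.comp (fst.comp (fst.comp fst))
    have hq : Primrec fun t : ((((((CodeRules × ℕ × List ℕ) × ScanCertificate) × CodeForm) ×
        List ℕ) × List ℕ) × List ℕ) × (ℕ × CodeForm) => t.1.1.2 :=
      snd.comp (fst.comp fst)
    have hr : Primrec fun t : ((((((CodeRules × ℕ × List ℕ) × ScanCertificate) × CodeForm) ×
        List ℕ) × List ℕ) × List ℕ) × (ℕ × CodeForm) => t.1.2 := snd.comp fst
    exact .and (Primrec.eq.comp (list_head?.comp hs)
      (option_some.comp (sumInr.comp (fst.comp snd)))) (.and
      (.list_mem ((snd.comp snd).pair (hp.pair hr)) hT') (.and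
      (.list_mem ((list_tail.comp hs).pair (hr.pair hq)) hT')
      (.not (.list_mem (hs.pair (hp.pair hq)) hT'))))

theorem computablePred_exists_yields_prefix :
    ComputablePred fun t : CodeRules × ℕ × List ℕ =>
      ∃ x, Yields t.1 [Sum.inr t.2.1] x ∧ t.2.2 <+: x := by
  rw [ComputablePred.computable_iff_re_compl_re']
  constructor
  -- A positive certificate consists of derivation steps and of the part of the derived word after
  -- the required prefix.
  · have h : PrimrecRel fun (t : CodeRules × ℕ × List ℕ)
        (k : List (CodeForm × (ℕ × CodeForm) × CodeForm) × List ℕ) =>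
        k.1.foldl (applyProduction t.1) [Sum.inr t.2.1] = (t.2.2 ++ k.2).map Sum.inl := by
      refine Primrec.eq.comp (list_foldl
        (h := fun (a : (CodeRules × ℕ × List ℕ) ×
          List (CodeForm × (ℕ × CodeForm) × CodeForm) × List ℕ) t =>
            applyProduction a.1.1 t.1 t.2) (fst.comp snd) ?_ ?_) ?_
      · exact list_cons.comp (sumInr.comp (fst.comp (snd.comp fst))) (Primrec.const [])
      · exact primrec_applyProduction.comp
          ((fst.comp (fst.comp fst)).pair ((fst.comp snd).pair (snd.comp snd)))
      · exact list_map (list_append.comp (snd.comp (snd.comp fst)) (snd.comp snd))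
          (sumInl.comp snd).to₂
    refine (REPred.exists_of_primrecRel h).of_eq fun t => ⟨?_, ?_⟩
    · rintro ⟨⟨ts, y⟩, h⟩
      exact ⟨_, yields_iff_exists_foldl.mpr ⟨ts, h⟩, List.prefix_append _ _⟩
    · rintro ⟨_, hx, y, rfl⟩
      obtain ⟨ts, h⟩ := yields_iff_exists_foldl.mp hx
      exact ⟨(ts, y), h⟩
  · refine (REPred.exists_of_primrecRel (p := fun (t : CodeRules × ℕ × List ℕ) k =>
      Refutes k t.1 t.2.1 t.2.2) primrecPred_refutes).of_eq fun t => ⟨?_, ?_⟩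
    · rintro ⟨k, hk⟩ ⟨x, hx, hp⟩
      exact hk.not_yields hx hp
    · exact fun h => exists_refutes fun x hx hp => h ⟨x, hx, hp⟩

theorem computablePred_exists_yields_pumpBound :
    ComputablePred fun t : GrammarCode × List ℕ × List ℕ =>
      ∃ x, Yields t.1.2 [Sum.inr t.1.1] x ∧
        t.2.1 ++ wordPow t.2.2 (pumpBound t.1.2 (t.2.1.length + t.2.2.length)) <+: x := by
  obtain ⟨f, hf, h⟩ := ComputablePred.computable_iff.mp computablePred_exists_yields_prefix
  have hu : Primrec fun t : GrammarCode × List ℕ × List ℕ => t.2.1 := fst.comp snd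
  have hv : Primrec fun t : GrammarCode × List ℕ × List ℕ => t.2.2 := snd.comp snd
  have hR : Primrec fun t : GrammarCode × List ℕ × List ℕ => t.1.2 := snd.comp fst
  have hg : Primrec fun t : GrammarCode × List ℕ × List ℕ => (t.1.2, t.1.1,
      t.2.1 ++ wordPow t.2.2 (pumpBound t.1.2 (t.2.1.length + t.2.2.length))) :=
    hR.pair ((fst.comp fst).pair (list_append.comp hu (primrec₂_wordPow.comp hv
      (primrec₂_pumpBound.comp hR (nat_add.comp (list_length.comp hu) (list_length.comp hv))))))
  exact ComputablePred.computable_iff.mpr ⟨_, hf.comp hg.to_comp,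
    funext fun t => congrFun h (t.1.2, t.1.1, _)⟩

end Computability

/-! ### Grammars and their codes -/

namespace GrammarCode.Describes

variable {σ : Type*} {G : ContextFreeGrammar σ} {e : σ → ℕ} {f : G.NT → ℕ} {c : GrammarCode}

theorem yields_of_derives (h : c.Describes G e f) {s : List (Symbol σ G.NT)} {x : List σ}
    (hs : G.Derives s (x.map Symbol.terminal)) :
    Yields c.2 (s.map (encodeSymbol e f)) (x.map e) := by
  induction hs using Relation.ReflTransGen.head_induction_on with
  | refl =>
    have := Yields.map_inl c.2 (x.map e)
    simpa [Function.comp_def, encodeSymbol] using this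
  | head hst _ ih =>
    obtain ⟨r, hr, hrw⟩ := hst
    obtain ⟨p, q, rfl, rfl⟩ := hrw.exists_parts
    simp only [List.map_append, List.map_cons, List.map_nil, List.append_assoc] at ih ⊢
    obtain ⟨y₁, y, hx, h₁, hy⟩ := ih.exists_of_append
    obtain ⟨y₂, y₃, rfl, h₂, h₃⟩ := hy.exists_of_append
    rw [hx]
    exact h₁.append (.nonterminal ((h.mem_rules_iff _).mpr ⟨r, hr, rfl⟩) h₂ h₃)

/-- All symbols come from `s` or from productions of `G`, so even an arbitrary numeric word `y`
derived from an encoded form is itself an encoding. -/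
theorem exists_derives_of_yields (h : c.Describes G e f) {t : CodeForm} {y : List ℕ}
    (ht : Yields c.2 t y) : ∀ s : List (Symbol σ G.NT), t = s.map (encodeSymbol e f) →
      ∃ x : List σ, y = x.map e ∧ G.Derives s (x.map Symbol.terminal) := by
  induction ht with
  | nil =>
    intro s hs
    obtain rfl : s = [] := List.map_eq_nil_iff.mp hs.symm
    exact ⟨[], rfl, .refl _⟩
  | terminal a _ ih =>
    intro s hs
    obtain ⟨b, s, rfl, hb, rfl⟩ := List.map_eq_cons_iff.mp hs.symm
    rcases b with b | B
    · obtain ⟨x, rfl, hx⟩ := ih s rfl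
      obtain rfl : e b = a := Sum.inl.inj hb
      exact ⟨b :: x, rfl, hx.append_left [Symbol.terminal b]⟩
    · cases hb
  | nonterminal hr _ _ ih₁ ih₂ =>
    intro s hs
    obtain ⟨b, s, rfl, hb, rfl⟩ := List.map_eq_cons_iff.mp hs.symm
    rcases b with b | B
    · cases hb
    · obtain ⟨r, hrG, hr⟩ := (h.mem_rules_iff _).mp hr
      obtain ⟨hA, rfl⟩ := Prod.mk.inj hr
      obtain rfl : B = r.input := h.nonterminal_injective ((Sum.inr.inj hb).trans hA)
      obtain ⟨x, rfl, hx⟩ := ih₁ _ rfl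
      obtain ⟨y, rfl, hy⟩ := ih₂ s rfl
      refine ⟨x ++ y, by simp, ?_⟩
      have h1 : G.Derives (Symbol.nonterminal r.input :: s) (r.output ++ s) :=
        ContextFreeGrammar.Produces.single ⟨r, hrG, .head s⟩
      rw [List.map_append]
      exact (h1.trans (hx.append_right s)).trans (hy.append_left _)

theorem mem_language_iff (h : c.Describes G e f) (x : List σ) :
    x ∈ G.language ↔ Yields c.2 [Sum.inr c.1] (x.map e) := by
  rw [ContextFreeGrammar.mem_language_iff, h.initial_eq]
  constructor
  · exact fun hx => h.yields_of_derives hx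
  · intro hx
    obtain ⟨y, hy, hd⟩ := h.exists_derives_of_yields hx [Symbol.nonterminal G.initial] rfl
    rwa [List.map_injective_iff.mpr h.terminal_injective hy]

theorem exists_yields_prefix_iff (h : c.Describes G e f) (z : List σ) :
    (∃ y, Yields c.2 [Sum.inr c.1] y ∧ z.map e <+: y) ↔ ∃ x ∈ G.language, z <+: x := by
  constructor
  · rintro ⟨y, hy, hp⟩
    obtain ⟨x, rfl, -⟩ := h.exists_derives_of_yields hy [Symbol.nonterminal G.initial]
      (by rw [h.initial_eq]; rfl)
    refine ⟨x, (h.mem_language_iff x).mpr hy, ?_⟩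
    exact (List.prefix_map_iff_of_injective h.terminal_injective).mp hp
  · rintro ⟨x, hx, hp⟩
    exact ⟨_, (h.mem_language_iff x).mp hx, hp.map e⟩

end GrammarCode.Describes

theorem mainTheorem6 :
    (∃ D : GrammarCode × List ℕ × List ℕ → Prop, ComputablePred D ∧
      ∀ (σ : Type*) [Finite σ] (G : ContextFreeGrammar σ) (e : σ → ℕ) (f : G.NT → ℕ)
        (c : GrammarCode), c.Describes G e f →
        ∀ (u v : List σ) (hv : v ≠ []),
          D (c, u.map e, v.map e) ↔ IsLimitOf (regularWord u v hv) G.language) ∧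
    (∀ (σ : Type*) [Finite σ] (v : List σ) (hv : v ≠ []),
      ∃ f : List σ → List Unit, IsGenSeqMapping f ∧
        (∀ y, f (v ++ y) = () :: f y) ∧
        (∀ x, ¬ v <+: x → f x = []) ∧
        ∀ (L : Language σ) (u : List σ),
          IsLimitOf (regularWord u v hv) L ↔
            Set.Infinite (f '' {y : List σ | y ∈ L.leftQuotient u})) := by
  refine ⟨⟨_, computablePred_exists_yields_pumpBound, ?_⟩,
    fun σ _ v hv => exists_genSeqMapping_isLimitOf_iff v hv⟩
  intro σ _ G e f c h u v hv
  have hv' : v.map e ≠ [] := by simpa using hv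
  rw [isLimitOf_regularWord_iff]
  simp only [← h.exists_yields_prefix_iff, List.map_append, map_wordPow]
  constructor
  · rintro ⟨x, hx, hp⟩
    exact forall_exists_wordPow_prefix hv' hx hp
  -- Here the exponent is specialised to `pumpBound`; `map_wordPow` lets powers be taken after
  -- encoding.
  · exact fun hall => hall _
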